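/- Let $D$ be a Krull domain with quotient field $K$, that is, an integral domain which is the intersection of a family of rank-one discrete valuation rings of $K$ such that every nonzero element of $D$ is a nonunit in only finitely many members of the family. Call $D$ a $\star$-domain if $a^2D\cap b^2D=(aD\cap bD)^2$ for all $a,b\in D$. Call a nonzero ideal $I$ of $D$ divisorial if $(I^{-1})^{-1}=I$, where $J^{-1}=\{x\in K : xJ\subseteq D\}$ for a nonzero fractional ideal $J$ of $D$. Then $D$ is a $\star$-domain if and only if $I^2$ is divisorial for every divisorial ideal $I$ of $D$. -/

import Mathlib

open scoped nonZeroDivisors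

/-- A domain `D` is a Krull domain if it is the intersection, inside its quotient field, of a
family of rank-one discrete valuation rings of the quotient field, such that every nonzero
element of `D` is a nonunit in only finitely many members of the family.
(The empty family is allowed: fields are Krull domains.) -/
def IsKrullDomain (D : Type*) [CommRing D] [IsDomain D] : Prop :=
  ∃ F : Set (ValuationSubring (FractionRing D)),
    (∀ V ∈ F, IsDiscreteValuationRing V) ∧
    (∀ x : FractionRing D, (∃ a : D, algebraMap D (FractionRing D) a = x) ↔ ∀ V ∈ F, x ∈ V) ∧
    (∀ a : D, a ≠ 0 → {V ∈ F | algebraMap D (FractionRing D) a ∈ V.nonunits}.Finite)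

/-- A domain `D` is a `⋆`-domain if `a²D ∩ b²D = (aD ∩ bD)²` for all `a, b ∈ D`. -/
def IsStarDomain (D : Type*) [CommRing D] [IsDomain D] : Prop :=
  ∀ a b : D,
    Ideal.span {a ^ 2} ⊓ Ideal.span {b ^ 2} = (Ideal.span {a} ⊓ Ideal.span {b}) ^ 2

/-- A nonzero ideal `I` of a domain `D` with quotient field `K` is divisorial if
`(I⁻¹)⁻¹ = I`, where `J⁻¹ = {x ∈ K | xJ ⊆ D}` for a nonzero fractional ideal `J`. -/
def Ideal.IsDivisorial {D : Type*} [CommRing D] [IsDomain D] (I : Ideal D) : Prop :=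
  I ≠ ⊥ ∧ ((I : FractionalIdeal D⁰ (FractionRing D))⁻¹)⁻¹ = I

open FractionalIdeal

/-! ### Inverses of fractional ideals. -/

section Multipliers

namespace FractionalIdeal

variable {R K : Type*} [CommRing R] [IsDomain R] [Field K] [Algebra R K] [IsFractionRing R K]

/-! The ideal `aD ∩ bD` is the inverse of `J = (1/a, 1/b)`, hence divisorial. In a Krull domain
every divisorial ideal has the form `t(aD ∩ bD)` (`IsKrullDomain.exists_eq_spanSingleton_mul_inf`),
so for a `⋆`-domain its square `t²(a²D ∩ b²D)` is divisorial.

Conversely, if `x ∈ a²D ∩ b²D` then `(x/ab)² ∈ D`, so `x/ab ∈ D` and `xJ² ⊆ D`. Complete integral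
closedness then puts `x` in the divisorial closure of `(J⁻¹)² = (aD ∩ bD)²`, which is that square
itself by assumption. -/

theorem inv_ne_zero_of_ne_zero {J : FractionalIdeal R⁰ K} (hJ : J ≠ 0) : J⁻¹ ≠ 0 := by
  intro h
  have h0 := bot_lt_mul_inv (I := J) hJ
  rw [h, mul_zero] at h0
  exact lt_irrefl _ h0

theorem mul_ne_zero_of_ne_zero {I J : FractionalIdeal R⁰ K} (hI : I ≠ 0) (hJ : J ≠ 0) :
    I * J ≠ 0 := by
  obtain ⟨x, hx, hxI⟩ := exists_ne_zero_mem_isInteger hI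
  obtain ⟨y, hy, hyJ⟩ := exists_ne_zero_mem_isInteger hJ
  intro h
  have h1 := mul_mem_mul hxI hyJ
  rw [h, mem_zero_iff, mul_eq_zero] at h1
  have h2 := IsFractionRing.injective R K
  rcases h1 with h1 | h1
  · exact hx (h2 (h1.trans (map_zero _).symm))
  · exact hy (h2 (h1.trans (map_zero _).symm))

theorem le_inv_iff_mul_le_one {X J : FractionalIdeal R⁰ K} (hJ : J ≠ 0) :
    X ≤ J⁻¹ ↔ X * J ≤ 1 := by
  rw [inv_eq, le_div_iff_mul_le hJ]

theorem inv_mul_le_one (J : FractionalIdeal R⁰ K) : J⁻¹ * J ≤ 1 := by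
  by_cases hJ : J = 0
  · simp [hJ]
  · exact (le_inv_iff_mul_le_one hJ).1 le_rfl

theorem le_inv_inv (J : FractionalIdeal R⁰ K) : J ≤ J⁻¹⁻¹ := by
  by_cases hJ : J = 0
  · simp [hJ]
  · rw [le_inv_iff_mul_le_one (inv_ne_zero_of_ne_zero hJ), mul_comm]
    exact inv_mul_le_one J

theorem inv_inv_inv_eq (J : FractionalIdeal R⁰ K) : J⁻¹⁻¹⁻¹ = J⁻¹ := by
  by_cases hJ : J = 0
  · simp [hJ, inv_zero']
  · exact le_antisymm
      (inv_anti_mono hJ (inv_ne_zero_of_ne_zero (inv_ne_zero_of_ne_zero hJ)) (le_inv_inv J))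
      (le_inv_inv _)

theorem inv_spanSingleton_mul {x : K} (hx : x ≠ 0) (J : FractionalIdeal R⁰ K) :
    (spanSingleton R⁰ x * J)⁻¹ = spanSingleton R⁰ x⁻¹ * J⁻¹ := by
  by_cases hJ : J = 0
  · simp [hJ, inv_zero']
  have h1 : spanSingleton R⁰ x * spanSingleton R⁰ x⁻¹ = 1 := by
    rw [spanSingleton_mul_spanSingleton, mul_inv_cancel₀ hx, spanSingleton_one]
  have h0 : spanSingleton R⁰ x * J ≠ 0 := mul_ne_zero_of_ne_zero (spanSingleton_ne_zero_iff.2 hx) hJ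
  apply le_antisymm
  · have h2 : spanSingleton R⁰ x * (spanSingleton R⁰ x * J)⁻¹ ≤ J⁻¹ := by
      rw [le_inv_iff_mul_le_one hJ]
      calc _ = (spanSingleton R⁰ x * J)⁻¹ * (spanSingleton R⁰ x * J) := by ring
        _ ≤ 1 := inv_mul_le_one _
    calc _ = spanSingleton R⁰ x⁻¹ * (spanSingleton R⁰ x * (spanSingleton R⁰ x * J)⁻¹) := by
            rw [← mul_assoc, mul_comm (spanSingleton R⁰ x⁻¹), h1, one_mul]
      _ ≤ _ := mul_le_mul_right h2 _
  · rw [le_inv_iff_mul_le_one h0]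
    calc _ = (spanSingleton R⁰ x * spanSingleton R⁰ x⁻¹) * (J⁻¹ * J) := by ring
      _ = J⁻¹ * J := by rw [h1, one_mul]
      _ ≤ 1 := inv_mul_le_one _

theorem spanSingleton_sup_ne_zero {R K : Type*} [CommRing R] [Field K]
    [Algebra R K] [IsFractionRing R K] {x : K} (hx : x ≠ 0) (y : K) :
    spanSingleton R⁰ x ⊔ spanSingleton R⁰ y ≠ 0 := fun h =>
  spanSingleton_ne_zero_iff (R := R) (S := R⁰).2 hx
    (FractionalIdeal.le_zero_iff.1 (h ▸ le_sup_left))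

theorem mem_inv_spanSingleton_sup {x y z : K} (hx : x ≠ 0) :
    z ∈ (spanSingleton R⁰ x ⊔ spanSingleton R⁰ y)⁻¹ ↔
      z * x ∈ (1 : FractionalIdeal R⁰ K) ∧ z * y ∈ (1 : FractionalIdeal R⁰ K) := by
  have h0 : spanSingleton R⁰ x ⊔ spanSingleton R⁰ y ≠ 0 := fun h =>
    spanSingleton_ne_zero_iff (R := R) (S := R⁰).2 hx (le_zero_iff.1 (h ▸ le_sup_left))
  rw [← spanSingleton_le_iff_mem, le_inv_iff_mul_le_one h0, sup_eq_add, mul_add,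
    ← sup_eq_add, sup_le_iff]
  simp only [spanSingleton_mul_spanSingleton, spanSingleton_le_iff_mem]

end FractionalIdeal

/-! ### Completely integrally closed domains. -/

variable {R K : Type*} [CommRing R] [IsDomain R] [Field K] [Algebra R K] [IsFractionRing R K]

variable (R K) in
/-- A domain in which every fractional ideal that multiplies some nonzero fractional ideal into
itself is integral; that is, a completely integrally closed domain. -/
def HasTrivialMultipliers : Prop :=
  ∀ A J : FractionalIdeal R⁰ K, J ≠ 0 → A * J ≤ J → A ≤ 1

namespace HasTrivialMultipliers

/-- The hypothesis says that `A` multiplies `J⁻¹` into itself. Thus `J⁻¹J` can be cancelled, as if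
`J` were invertible. -/
theorem le_one_of_mul_inv_mul_le_one (h : HasTrivialMultipliers R K)
    {A J : FractionalIdeal R⁰ K} (hJ : J ≠ 0) (hA : A * (J⁻¹ * J) ≤ 1) : A ≤ 1 := by
  refine h A J⁻¹ (inv_ne_zero_of_ne_zero hJ) ?_
  rw [le_inv_iff_mul_le_one hJ, mul_assoc]
  exact hA

theorem mul_le_one (h : HasTrivialMultipliers R K) {X Z J : FractionalIdeal R⁰ K}
    (hJ : J ≠ 0) (hX : X * J ^ 2 ≤ 1) (hZ : Z * J⁻¹ ^ 2 ≤ 1) : X * Z ≤ 1 := by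
  apply h.le_one_of_mul_inv_mul_le_one hJ
  apply h.le_one_of_mul_inv_mul_le_one hJ
  calc _ = (X * J ^ 2) * (Z * J⁻¹ ^ 2) := by ring
    _ ≤ 1 * 1 := mul_le_mul' hX hZ
    _ = 1 := one_mul 1

theorem le_sq_inv_inv_inv (h : HasTrivialMultipliers R K) {X J : FractionalIdeal R⁰ K}
    (hJ : J ≠ 0) (hX : X * J ^ 2 ≤ 1) : X ≤ (J⁻¹ ^ 2)⁻¹⁻¹ := by
  have h1 : J⁻¹ ^ 2 ≠ 0 := by
    rw [pow_two]
    exact mul_ne_zero_of_ne_zero (inv_ne_zero_of_ne_zero hJ) (inv_ne_zero_of_ne_zero hJ)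
  rw [le_inv_iff_mul_le_one (inv_ne_zero_of_ne_zero h1)]
  exact h.mul_le_one hJ hX (inv_mul_le_one _)

theorem mem_one_of_sq_mem_one {R K : Type*} [CommRing R] [Field K]
    [Algebra R K] [IsFractionRing R K] (h : HasTrivialMultipliers R K) {x : K}
    (hx : x ^ 2 ∈ (1 : FractionalIdeal R⁰ K)) : x ∈ (1 : FractionalIdeal R⁰ K) := by
  rw [← spanSingleton_le_iff_mem]
  -- As `x² ∈ R`, the module `R + xR` is stable under `x`.
  refine h _ (1 ⊔ spanSingleton R⁰ x) (fun h0 => ?_) ?_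
  · have h1 : (1 : FractionalIdeal R⁰ K) ≠ 0 := by
      rw [← spanSingleton_one]
      exact spanSingleton_ne_zero_iff.2 one_ne_zero
    exact h1 (FractionalIdeal.le_zero_iff.1 (h0 ▸ (le_sup_left : (1 : FractionalIdeal R⁰ K) ≤ _)))
  · rw [sup_eq_add, mul_add, mul_one, spanSingleton_mul_spanSingleton, ← sup_eq_add, ← sup_eq_add,
      ← pow_two]
    exact sup_le le_sup_right ((spanSingleton_le_iff_mem.2 hx).trans le_sup_left)

end HasTrivialMultipliers

end Multipliers

/-! ### Krull domains: complete integral closedness and finiteness of divisorial ideals. -/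

section Krull

theorem ValuationSubring.mem_of_forall_mul_pow_mem {K : Type*} [Field K] (V : ValuationSubring K)
    [IsNoetherianRing V] {x c : K} (hc : c ≠ 0) (h : ∀ n : ℕ, c * x ^ n ∈ V) : x ∈ V := by
  have hcV : c ∈ V := by simpa using h 0
  have h1 : IsAlmostIntegral V x := by
    refine ⟨⟨c, hcV⟩, mem_nonZeroDivisors_of_ne_zero fun h0 => hc (congrArg Subtype.val h0),
      fun n => ⟨⟨_, h n⟩, rfl⟩⟩
  have h2 : IsIntegral V x := h1.isIntegral_of_nonZeroDivisors_le_comap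
    (nonZeroDivisors_le_comap_nonZeroDivisors_of_injective _ (IsFractionRing.injective V K))
  obtain ⟨y, rfl⟩ := IsIntegrallyClosed.isIntegral_iff.1 h2
  exact y.2

theorem IsDedekindDomain.finite_setOf_mem_ideal {R : Type*} [CommRing R] [IsDedekindDomain R]
    {r : R} (hr : r ≠ 0) : {I : Ideal R | r ∈ I}.Finite := by
  have := UniqueFactorizationMonoid.fintypeSubtypeDvd (Ideal.span {r})
    (by simpa [Ideal.zero_eq_bot] using hr)
  have hfin : {I : Ideal R | I ∣ Ideal.span {r}}.Finite := Set.finite_coe_iff.1 this.finite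
  refine hfin.subset fun I hI => ?_
  rw [Set.mem_ofPred_eq, Ideal.dvd_iff_le, Ideal.span_singleton_le_iff_mem]
  exact hI

variable {D : Type*} [CommRing D] [IsDomain D]

/-- For `x ∈ A`, `y ∈ J` and `w ∈ J⁻¹`, all `w y xⁿ` lie in `D`, so `x` is almost integral over each
valuation ring, hence in it. -/
theorem IsKrullDomain.hasTrivialMultipliers (hD : IsKrullDomain D) :
    HasTrivialMultipliers D (FractionRing D) := by
  obtain ⟨F, hF, hF1, -⟩ := hD
  intro A J hJ hA x hx
  refine (mem_one_iff _).2 ?_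
  refine (hF1 x).2 fun V hV => ?_
  have := hF V hV
  obtain ⟨y, hy0, hyJ⟩ := exists_ne_zero_mem_isInteger hJ
  have hpow : ∀ n : ℕ, x ^ n * algebraMap D (FractionRing D) y ∈ J := by
    intro n
    induction n with
    | zero => simpa using hyJ
    | succ n ih =>
      rw [pow_succ', mul_assoc]
      exact hA (mul_mem_mul hx ih)
  obtain ⟨w, hw, hw0⟩ : ∃ w ∈ J⁻¹, w ≠ 0 := by
    by_contra! h
    exact inv_ne_zero_of_ne_zero hJ (FractionalIdeal.eq_zero_iff.2 h)
  have hy1 : algebraMap D (FractionRing D) y ≠ 0 := by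
    simpa using hy0
  refine V.mem_of_forall_mul_pow_mem (mul_ne_zero hw0 hy1) fun n => ?_
  obtain ⟨d, hd⟩ := (mem_one_iff _).1 ((mem_inv_iff hJ).1 hw _ (hpow n))
  have : w * algebraMap D (FractionRing D) y * x ^ n = algebraMap D (FractionRing D) d := by
    rw [hd]; ring
  rw [this]
  exact (hF1 _).1 ⟨d, rfl⟩ V hV

theorem Ideal.IsDivisorial.mem_of_forall {I : Ideal D} (hI : I.IsDivisorial) {x : D}
    (h : ∀ y ∈ (I : FractionalIdeal D⁰ (FractionRing D))⁻¹,
      algebraMap D (FractionRing D) x * y ∈ (1 : FractionalIdeal D⁰ (FractionRing D))) :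
    x ∈ I := by
  have h0 : (I : FractionalIdeal D⁰ (FractionRing D)) ≠ 0 := coeIdeal_ne_zero.2 hI.1
  have h1 := (mem_inv_iff (inv_ne_zero_of_ne_zero h0)).2 h
  rw [hI.2] at h1
  obtain ⟨y, hy, hyx⟩ := (mem_coeIdeal D⁰).1 h1
  rwa [← IsFractionRing.injective D (FractionRing D) hyx]

/-- A divisorial ideal is determined by its extensions to the valuation rings. If it contains `a`,
these are trivial wherever `a` is a unit, and each of the finitely many other rings has only
finitely many ideals containing `a`. -/
theorem IsKrullDomain.finite_setOf_isDivisorial (hD : IsKrullDomain D) {a : D} (ha : a ≠ 0) :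
    {I : Ideal D | I.IsDivisorial ∧ a ∈ I}.Finite := by
  obtain ⟨F, hF, hF1, hF2⟩ := hD
  have hmem : ∀ V ∈ F, ∀ d, algebraMap D (FractionRing D) d ∈ V := fun V hV d =>
    (hF1 _).1 ⟨d, rfl⟩ V hV
  let f (V : F) : D →+* V.1 := (algebraMap D (FractionRing D)).codRestrict V.1 (hmem V.1 V.2)
  have hf0 (V : F) : f V a ≠ 0 := fun h => ha <| by
    have := congrArg Subtype.val h
    simpa [f] using this
  have key : ∀ I J : Ideal D, J.IsDivisorial → (∀ V, I.map (f V) ≤ J.map (f V)) → I ≤ J := by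
    intro I J hJ h x hx
    refine hJ.mem_of_forall fun y hy => ?_
    rw [mem_one_iff]
    refine (hF1 _).2 fun V hV => ?_
    have hxV : f ⟨V, hV⟩ x ∈ J.map (f ⟨V, hV⟩) := h _ (Ideal.mem_map_of_mem _ hx)
    have hind : ∀ v ∈ J.map (f ⟨V, hV⟩), (v : FractionRing D) * y ∈ V := by
      intro v hv
      refine Submodule.span_induction ?_ ?_ ?_ ?_ hv
      · rintro _ ⟨j, hj, rfl⟩
        obtain ⟨d, hd⟩ := (mem_one_iff _).1
          ((mem_inv_iff (coeIdeal_ne_zero.2 hJ.1)).1 hy _ (mem_coeIdeal_of_mem D⁰ hj))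
        have : (f ⟨V, hV⟩ j : FractionRing D) * y = algebraMap D _ d := by
          rw [hd, mul_comm]; rfl
        rw [this]
        exact hmem V hV d
      · simp
      · intro v w _ _ hv hw
        rw [V.coe_add, add_mul]
        exact V.add_mem _ _ hv hw
      · intro c v _ hv
        rw [smul_eq_mul, V.coe_mul, mul_assoc]
        exact V.mul_mem _ _ c.2 hv
    exact hind _ hxV
  let T := {V ∈ F | algebraMap D (FractionRing D) a ∈ V.nonunits}
  have hT : Finite T := hF2 a ha
  let g (I : Ideal D) (V : T) : Ideal V.1 := I.map (f ⟨V.1, V.2.1⟩)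
  have hfin : {h : (V : T) → Ideal V.1 | ∀ V, h V ∈ {I | f ⟨V.1, V.2.1⟩ a ∈ I}}.Finite :=
    Set.Finite.pi' fun V => by
      have := hF V.1 V.2.1
      exact IsDedekindDomain.finite_setOf_mem_ideal (hf0 ⟨V.1, V.2.1⟩)
  refine Set.Finite.of_injOn (f := g) ?_ ?_ hfin
  · intro I hI V
    exact Ideal.mem_map_of_mem (f ⟨V.1, V.2.1⟩) hI.2
  have hle : ∀ I J : Ideal D, J.IsDivisorial → a ∈ J → g I = g J → I ≤ J := by
    intro I J hJ haJ h
    refine key I J hJ fun V => ?_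
    by_cases hV : algebraMap D (FractionRing D) a ∈ V.1.nonunits
    · exact (congrFun h ⟨V.1, V.2, hV⟩).le
    · have hu : IsUnit (f V a) := by
        by_contra hn
        exact hV (ValuationSubring.coe_mem_nonunits_iff.2 hn)
      rw [Ideal.eq_top_of_isUnit_mem _ (Ideal.mem_map_of_mem (f V) haJ) hu]
      exact le_top
  intro I hI J hJ h
  exact le_antisymm (hle I J hJ.1 hJ.2 h) (hle J I hI.1 hI.2 h.symm)

/-- A finite family of submodules with pairwise incomparable prime colon ideals, each acting
without torsion on the quotient, does not cover the ambient submodule. -/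
theorem Ideal.exists_mem_forall_notMem {R ι : Type*} [CommRing R] {I : Ideal R} (s : Finset ι)
    (M P : ι → Ideal R) (hP : ∀ i ∈ s, (P i).IsPrime)
    (hPM : ∀ i ∈ s, ∀ x ∈ P i, ∀ c ∈ I, x * c ∈ M i)
    (htf : ∀ i ∈ s, ∀ x c, c ∈ I → x * c ∈ M i → c ∈ M i ∨ x ∈ P i)
    (hMI : ∀ i ∈ s, ¬ I ≤ M i) (hne : ∀ i ∈ s, ∀ j ∈ s, P j ≤ P i → j = i) :
    ∃ b ∈ I, ∀ i ∈ s, b ∉ M i := by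
  classical
  -- As in prime avoidance: the sum of such elements lies in no `M i`.
  have h1 : ∀ i ∈ s, ∃ b ∈ I, b ∉ M i ∧ ∀ j ∈ s, j ≠ i → b ∈ M j := by
    intro i hi
    obtain ⟨c, hcI, hcM⟩ := SetLike.not_le_iff_exists.1 (hMI i hi)
    have h2 : ¬ (s.erase i).prod P ≤ P i := by
      rw [(hP i hi).prod_le]
      rintro ⟨j, hj, hji⟩
      exact Finset.ne_of_mem_erase hj (hne i hi j (Finset.mem_of_mem_erase hj) hji)
    obtain ⟨x, hx, hxP⟩ := SetLike.not_le_iff_exists.1 h2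
    refine ⟨x * c, I.mul_mem_left _ hcI, fun h => ?_, fun j hj hji => ?_⟩
    · exact (htf i hi x c hcI h).elim hcM hxP
    · have hxj : x ∈ P j :=
        Ideal.prod_le_inf.trans (Finset.inf_le (Finset.mem_erase.2 ⟨hji, hj⟩)) hx
      exact hPM j hj x hxj c hcI
  choose! b hbI hbM hbj using h1
  refine ⟨∑ i ∈ s, b i, I.sum_mem hbI, fun i hi h => hbM i hi ?_⟩
  rw [← Finset.add_sum_erase _ _ hi] at h
  refine (Ideal.add_mem_iff_left _ (Ideal.sum_mem _ fun j hj => ?_)).1 h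
  exact hbj j (Finset.mem_of_mem_erase hj) i hi (Finset.ne_of_mem_erase hj).symm

/-! ### Divisorial closure. -/

theorem Ideal.exists_isDivisorial_coe_eq {J : FractionalIdeal D⁰ (FractionRing D)}
    (hJ : J ≠ 0) (hJ1 : J⁻¹ ≤ 1) :
    ∃ L : Ideal D, L.IsDivisorial ∧ (L : FractionalIdeal D⁰ (FractionRing D)) = J⁻¹ := by
  obtain ⟨L, hL⟩ := le_one_iff_exists_coeIdeal.1 hJ1
  refine ⟨L, ⟨?_, ?_⟩, hL⟩
  · rw [← coeIdeal_ne_zero (K := FractionRing D), hL]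
    exact inv_ne_zero_of_ne_zero hJ
  · rw [hL, inv_inv_inv_eq]

theorem FractionalIdeal.inv_inv_le_one {J : FractionalIdeal D⁰ (FractionRing D)} (hJ : J ≠ 0)
    (hJ1 : J ≤ 1) : J⁻¹⁻¹ ≤ 1 := by
  have h1 : (1 : FractionalIdeal D⁰ (FractionRing D)) ≤ J⁻¹ := by
    rwa [le_inv_iff_mul_le_one hJ, one_mul]
  calc J⁻¹⁻¹ = J⁻¹⁻¹ * 1 := (mul_one _).symm
    _ ≤ J⁻¹⁻¹ * J⁻¹ := mul_le_mul_right h1 _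
    _ ≤ 1 := inv_mul_le_one _

theorem FractionalIdeal.mul_inv_inv_le {A J L : FractionalIdeal D⁰ (FractionRing D)}
    (hJ : J ≠ 0) (hL : L ≠ 0) (h : A * J ≤ L⁻¹) : A * J⁻¹⁻¹ ≤ L⁻¹ := by
  rw [le_inv_iff_mul_le_one hL] at h ⊢
  have h1 : A * L ≤ J⁻¹ := by
    rw [le_inv_iff_mul_le_one hJ]
    calc _ = A * J * L := by ring
      _ ≤ 1 := h
  calc _ = J⁻¹⁻¹ * (A * L) := by ring
    _ ≤ J⁻¹⁻¹ * J⁻¹ := mul_le_mul_right h1 _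
    _ ≤ 1 := inv_mul_le_one _

/-- The divisorial closure of a nonzero ideal, with its universal property for multiples. -/
theorem Ideal.exists_divisorial_closure {J : Ideal D} (hJ : J ≠ ⊥) :
    ∃ L : Ideal D, L.IsDivisorial ∧ J ≤ L ∧
      (L : FractionalIdeal D⁰ (FractionRing D)) =
        (J : FractionalIdeal D⁰ (FractionRing D))⁻¹⁻¹ ∧
      ∀ (x : D) (M : Ideal D), M.IsDivisorial → (∀ c ∈ J, x * c ∈ M) → ∀ c ∈ L, x * c ∈ M := by
  have h0 : (J : FractionalIdeal D⁰ (FractionRing D)) ≠ 0 := coeIdeal_ne_zero.2 hJ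
  obtain ⟨L, hL, hLJ⟩ := Ideal.exists_isDivisorial_coe_eq (inv_ne_zero_of_ne_zero h0)
    (inv_inv_le_one h0 coeIdeal_le_one)
  refine ⟨L, hL, ?_, hLJ, fun x M hM hx => ?_⟩
  · rw [← coeIdeal_le_coeIdeal (FractionRing D), hLJ]
    exact le_inv_inv _
  · have h1 : spanSingleton D⁰ (algebraMap D (FractionRing D) x) *
        (J : FractionalIdeal D⁰ (FractionRing D)) ≤
          (M : FractionalIdeal D⁰ (FractionRing D))⁻¹⁻¹ := by
      rw [hM.2, spanSingleton_mul_le_iff]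
      intro z hz
      obtain ⟨c, hc, rfl⟩ := (mem_coeIdeal D⁰).1 hz
      rw [← map_mul]
      exact mem_coeIdeal_of_mem D⁰ (hx c hc)
    have h2 := mul_inv_inv_le h0 (inv_ne_zero_of_ne_zero (coeIdeal_ne_zero.2 hM.1)) h1
    rw [hM.2, spanSingleton_mul_le_iff, ← hLJ] at h2
    intro c hc
    obtain ⟨d, hd, hdx⟩ := (mem_coeIdeal D⁰).1 (h2 _ (mem_coeIdeal_of_mem D⁰ hc))
    rw [← map_mul] at hdx
    rwa [← IsFractionRing.injective D (FractionRing D) hdx]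

/-- For `n ∈ N`, `w ∈ I⁻¹`, the element `wn` of `D` maps `I` into `nD ⊆ N`, hence into `M`. So any
`y ∈ M⁻¹` gives `ny I⁻¹I ⊆ D`, and `I⁻¹I` cancels. -/
theorem HasTrivialMultipliers.le_of_colon_le (h : HasTrivialMultipliers D (FractionRing D))
    {I M N : Ideal D} (hI : I ≠ ⊥) (hM : M.IsDivisorial) (hNI : N ≤ I)
    (hNM : ∀ x, (∀ c ∈ I, x * c ∈ N) → ∀ c ∈ I, x * c ∈ M) : N ≤ M := by
  have hI0 : (I : FractionalIdeal D⁰ (FractionRing D)) ≠ 0 := coeIdeal_ne_zero.2 hI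
  intro n hn
  refine hM.mem_of_forall fun y hy => ?_
  have hsp : spanSingleton D⁰ (algebraMap D (FractionRing D) n * y) ≤ 1 := by
    refine h.le_one_of_mul_inv_mul_le_one hI0 ?_
    rw [← mul_assoc, FractionalIdeal.mul_le]
    intro i hi j hj
    obtain ⟨w, hw, rfl⟩ := mem_singleton_mul.1 hi
    obtain ⟨x, hx⟩ := (mem_one_iff _).1
      ((mem_inv_iff hI0).1 hw _ (mem_coeIdeal_of_mem D⁰ (hNI hn)))
    have hxM := hNM x fun c hc => by
      obtain ⟨d, hd⟩ := (mem_one_iff _).1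
        ((mem_inv_iff hI0).1 hw _ (mem_coeIdeal_of_mem D⁰ hc))
      have : x * c = d * n := by
        apply IsFractionRing.injective D (FractionRing D)
        rw [map_mul, map_mul, hx, hd]
        ring
      exact this ▸ N.mul_mem_left _ hn
    obtain ⟨c, hc, rfl⟩ := (mem_coeIdeal D⁰).1 hj
    have h1 := (mem_inv_iff (coeIdeal_ne_zero.2 hM.1)).1 hy _
      (mem_coeIdeal_of_mem D⁰ (hxM c hc))
    rw [map_mul, hx] at h1
    convert h1 using 1
    ring
  exact spanSingleton_le_iff_mem.1 hsp

/-! ### Two elements generate a divisorial ideal up to closure. -/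

/-- It suffices that `b` avoid the finitely many maximal divisorial ideals `M` with `a ∈ M < I`.
Their colons `(M : I)` are pairwise incomparable primes, so these `M` do not cover `I`. -/
theorem IsKrullDomain.exists_forall_isDivisorial_le (hD : IsKrullDomain D) {I : Ideal D}
    (hI : I.IsDivisorial) {a : D} (ha : a ≠ 0) :
    ∃ b ∈ I, ∀ L : Ideal D, L.IsDivisorial → a ∈ L → b ∈ L → L ≤ I → L = I := by
  let S : Set (Ideal D) := {L | (L.IsDivisorial ∧ a ∈ L) ∧ L < I}
  have hS : S.Finite := (hD.finite_setOf_isDivisorial ha).subset fun L hL => hL.1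
  have hmaxfin : {M | Maximal (· ∈ S) M}.Finite := hS.subset fun M hM => hM.prop
  -- If `c ∉ M`, maximality makes `I` the closure of `M + cD`; since `x` maps `M + cD` into `M`, it
  -- maps `I` there too.
  have hcl : ∀ M, Maximal (· ∈ S) M → ∀ x c, c ∈ I → x * c ∈ M →
      c ∈ M ∨ x ∈ M.colon (I : Set D) := by
    intro M hM x c hc hxc
    by_contra! hn
    have hle : M ⊔ Ideal.span {c} ≤ I :=
      sup_le hM.prop.2.le ((Ideal.span_singleton_le_iff_mem I).2 hc)
    have hne : M ⊔ Ideal.span {c} ≠ ⊥ := fun h0 =>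
      ha ((Submodule.mem_bot D).1 (h0 ▸ Ideal.mem_sup_left hM.prop.1.2))
    obtain ⟨L, hL, hML, -, hLx⟩ := Ideal.exists_divisorial_closure hne
    have hLI : L ≤ I := by
      intro z hz
      simpa using hLx 1 I hI (fun c hc => by simpa using hle hc) z hz
    have hcL : c ∈ L := hML (Ideal.mem_sup_right (Ideal.mem_span_singleton_self c))
    have haL : a ∈ L := hML (Ideal.mem_sup_left hM.prop.1.2)
    have hIL : L = I := by
      by_contra hLne
      exact hn.1 (hM.le_of_ge ⟨⟨hL, haL⟩, lt_of_le_of_ne hLI hLne⟩ (le_sup_left.trans hML) hcL)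
    apply hn.2
    rw [Submodule.mem_colon]
    intro d hd
    refine hLx x M hM.prop.1.1 (fun e he => ?_) d (hIL ▸ hd)
    obtain ⟨m, hm, y, hy, rfl⟩ := Submodule.mem_sup.1 he
    obtain ⟨t, rfl⟩ := Ideal.mem_span_singleton'.1 hy
    rw [mul_add, mul_left_comm]
    exact M.add_mem (M.mul_mem_left _ hm) (M.mul_mem_left _ hxc)
  have hcover : ∃ b ∈ I, ∀ M ∈ hmaxfin.toFinset, b ∉ id M := by
    refine Ideal.exists_mem_forall_notMem hmaxfin.toFinset id
      (fun M => M.colon (I : Set D)) ?_ ?_ ?_ ?_ ?_ <;>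
    simp only [Set.Finite.mem_toFinset, Set.mem_ofPred_eq, id]
    · intro M hM
      refine ⟨fun htop => ?_, fun {x y} hxy => ?_⟩
      · refine not_le_of_gt hM.prop.2 fun c hc => ?_
        have := Submodule.mem_colon.1 ((Ideal.eq_top_iff_one _).1 htop) c hc
        simpa using this
      · by_contra! hn
        apply hn.2
        rw [Submodule.mem_colon]
        intro c hc
        rw [Submodule.mem_colon] at hxy
        have h1 := hxy c hc
        rw [smul_eq_mul, mul_assoc] at h1
        exact (hcl M hM x (y * c) (I.mul_mem_left _ hc) h1).resolve_right hn.1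
    · intro M hM x hx c hc
      exact Submodule.mem_colon.1 hx c hc
    · exact hcl
    · intro M hM
      exact not_le_of_gt hM.prop.2
    · intro M hM N hN hle
      have : N ≤ M := hD.hasTrivialMultipliers.le_of_colon_le hI.1 hM.prop.1.1 hN.prop.2.le
        fun x hx => Submodule.mem_colon.1 (hle (Submodule.mem_colon.2 hx))
      exact le_antisymm this (hN.le_of_ge hM.prop this)
  obtain ⟨b, hb, hbM⟩ := hcover
  refine ⟨b, hb, fun L hL haL hbL hLI => ?_⟩
  by_contra hne
  obtain ⟨M, hLM, hM⟩ := hS.exists_le_maximal (a := L) ⟨⟨hL, haL⟩, lt_of_le_of_ne hLI hne⟩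
  exact hbM M (hmaxfin.mem_toFinset.2 hM) (hLM hbL)

/-! ### Intersections of two principal ideals, and the equivalence. -/

theorem FractionalIdeal.inv_spanSingleton_inv_sup {a b : D} (ha : a ≠ 0) (hb : b ≠ 0) :
    (spanSingleton D⁰ (algebraMap D (FractionRing D) a)⁻¹ ⊔
      spanSingleton D⁰ (algebraMap D (FractionRing D) b)⁻¹)⁻¹ =
      ((Ideal.span {a} ⊓ Ideal.span {b} : Ideal D) :
        FractionalIdeal D⁰ (FractionRing D)) := by
  have ha' : algebraMap D (FractionRing D) a ≠ 0 := by simpa using ha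
  have hb' : algebraMap D (FractionRing D) b ≠ 0 := by simpa using hb
  ext z
  rw [mem_inv_spanSingleton_sup (inv_ne_zero ha')]
  constructor
  · rintro ⟨h1, h2⟩
    obtain ⟨c, hc⟩ := (mem_one_iff _).1 h1
    obtain ⟨d, hd⟩ := (mem_one_iff _).1 h2
    rw [eq_mul_inv_iff_mul_eq₀ ha', ← map_mul] at hc
    rw [eq_mul_inv_iff_mul_eq₀ hb', ← map_mul] at hd
    have hcd : c * a = d * b := IsFractionRing.injective D (FractionRing D) (hc.trans hd.symm)
    rw [← hc]
    refine mem_coeIdeal_of_mem D⁰ ⟨Ideal.mem_span_singleton'.2 ⟨c, rfl⟩, ?_⟩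
    exact Ideal.mem_span_singleton'.2 ⟨d, hcd.symm⟩
  · intro hz
    obtain ⟨x, ⟨h1, h2⟩, rfl⟩ := (mem_coeIdeal D⁰).1 hz
    obtain ⟨c, hc⟩ := Ideal.mem_span_singleton'.1 h1
    obtain ⟨d, hd⟩ := Ideal.mem_span_singleton'.1 h2
    constructor
    · rw [mem_one_iff]
      exact ⟨c, by rw [← hc, map_mul, mul_inv_cancel_right₀ ha']⟩
    · rw [mem_one_iff]
      exact ⟨d, by rw [← hd, map_mul, mul_inv_cancel_right₀ hb']⟩

theorem Ideal.isDivisorial_span_inf_span {a b : D} (ha : a ≠ 0) (hb : b ≠ 0) :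
    (Ideal.span {a} ⊓ Ideal.span {b}).IsDivisorial := by
  refine ⟨fun h => mul_ne_zero ha hb ?_, ?_⟩
  · rw [← Submodule.mem_bot D, ← h]
    exact ⟨Ideal.mul_mem_right _ _ (Ideal.mem_span_singleton_self a),
      Ideal.mul_mem_left _ _ (Ideal.mem_span_singleton_self b)⟩
  · rw [← inv_spanSingleton_inv_sup ha hb, inv_inv_inv_eq]

theorem Ideal.sq_span_inf_span_le {D : Type*} [CommRing D] (a b : D) :
    (Ideal.span {a} ⊓ Ideal.span {b}) ^ 2 ≤ Ideal.span {a ^ 2} ⊓ Ideal.span {b ^ 2} := by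
  simp only [← Ideal.span_singleton_pow]
  exact le_inf (Ideal.pow_right_mono inf_le_left 2) (Ideal.pow_right_mono inf_le_right 2)

theorem HasTrivialMultipliers.isStarDomain (h : HasTrivialMultipliers D (FractionRing D))
    (hdiv : ∀ I : Ideal D, I.IsDivisorial → (I ^ 2).IsDivisorial) : IsStarDomain D := by
  intro a b
  by_cases ha : a = 0
  · simp [ha]
  by_cases hb : b = 0
  · simp [hb]
  refine le_antisymm (fun x hx => ?_) (Ideal.sq_span_inf_span_le a b)
  have ha' : (algebraMap D (FractionRing D) a)⁻¹ ≠ 0 := by simpa using ha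
  let J := spanSingleton D⁰ (algebraMap D (FractionRing D) a)⁻¹ ⊔
    spanSingleton D⁰ (algebraMap D (FractionRing D) b)⁻¹
  have hJ : J ≠ 0 := spanSingleton_sup_ne_zero ha' _
  have hx1 := mem_coeIdeal_of_mem (P := FractionRing D) D⁰ hx
  rw [← inv_spanSingleton_inv_sup (pow_ne_zero 2 ha) (pow_ne_zero 2 hb),
    mem_inv_spanSingleton_sup (by simpa using ha)] at hx1
  simp only [map_pow] at hx1
  obtain ⟨h1, h2⟩ := hx1
  have h3 : algebraMap D (FractionRing D) x *
      ((algebraMap D (FractionRing D) a)⁻¹ * (algebraMap D (FractionRing D) b)⁻¹) ∈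
      (1 : FractionalIdeal D⁰ (FractionRing D)) := by
    apply h.mem_one_of_sq_mem_one
    have h4 := mul_mem_mul h1 h2
    rw [mul_one] at h4
    convert h4 using 1
    ring
  have hXJ : spanSingleton D⁰ (algebraMap D (FractionRing D) x) * J ^ 2 ≤ 1 := by
    have : J ^ 2 =
        spanSingleton D⁰ ((algebraMap D (FractionRing D) a) ^ 2)⁻¹ ⊔
          spanSingleton D⁰
            ((algebraMap D (FractionRing D) a)⁻¹ * (algebraMap D (FractionRing D) b)⁻¹) ⊔
          (spanSingleton D⁰
            ((algebraMap D (FractionRing D) a)⁻¹ * (algebraMap D (FractionRing D) b)⁻¹) ⊔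
          spanSingleton D⁰ ((algebraMap D (FractionRing D) b) ^ 2)⁻¹) := by
      simp only [J, sup_eq_add, ← inv_pow, ← spanSingleton_pow,
        ← spanSingleton_mul_spanSingleton]
      ring
    rw [this]
    simp only [sup_eq_add, mul_add, spanSingleton_mul_spanSingleton]
    simp only [← sup_eq_add, sup_le_iff, spanSingleton_le_iff_mem]
    exact ⟨⟨h1, h3⟩, h3, h2⟩
  have hle := h.le_sq_inv_inv_inv hJ hXJ
  have hI := (hdiv _ (Ideal.isDivisorial_span_inf_span ha hb)).2
  rw [inv_spanSingleton_inv_sup ha hb, ← coeIdeal_pow, hI, spanSingleton_le_iff_mem] at hle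
  obtain ⟨y, hy, hyx⟩ := (mem_coeIdeal D⁰).1 hle
  rwa [← IsFractionRing.injective D (FractionRing D) hyx]

theorem IsKrullDomain.exists_inv_eq_inv_sup (hD : IsKrullDomain D) {I : Ideal D}
    (hI : I.IsDivisorial) :
    ∃ a b : D, a ≠ 0 ∧ b ≠ 0 ∧ (I : FractionalIdeal D⁰ (FractionRing D))⁻¹ =
      (spanSingleton D⁰ (algebraMap D (FractionRing D) a) ⊔
        spanSingleton D⁰ (algebraMap D (FractionRing D) b))⁻¹ := by
  obtain ⟨a, haI, ha⟩ := Submodule.exists_mem_ne_zero_of_ne_bot hI.1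
  obtain ⟨b, hbI, hb⟩ := hD.exists_forall_isDivisorial_le hI ha
  have key : ∀ c ∈ I, (∀ L : Ideal D, L.IsDivisorial → a ∈ L → c ∈ L → L ≤ I → L = I) →
      (I : FractionalIdeal D⁰ (FractionRing D))⁻¹ =
      (spanSingleton D⁰ (algebraMap D (FractionRing D) a) ⊔
        spanSingleton D⁰ (algebraMap D (FractionRing D) c))⁻¹ := by
    intro c hcI hc
    have hle : Ideal.span {a} ⊔ Ideal.span {c} ≤ I :=
      sup_le ((Ideal.span_singleton_le_iff_mem I).2 haI)
        ((Ideal.span_singleton_le_iff_mem I).2 hcI)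
    have haJ : a ∈ Ideal.span {a} ⊔ Ideal.span {c} :=
      Ideal.mem_sup_left (Ideal.mem_span_singleton_self a)
    obtain ⟨L, hL, hJL, hLJ, hLx⟩ := Ideal.exists_divisorial_closure
      (fun h => ha ((Submodule.mem_bot D).1 (h ▸ haJ)))
    have hLI : L ≤ I := by
      intro z hz
      simpa using hLx 1 I hI (fun c hc => by simpa using hle hc) z hz
    have := hc L hL (hJL haJ)
      (hJL (Ideal.mem_sup_right (Ideal.mem_span_singleton_self c))) hLI
    rw [← this, hLJ, inv_inv_inv_eq, coeIdeal_sup, coeIdeal_span_singleton,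
      coeIdeal_span_singleton, sup_eq_add]
  -- If `b = 0`, then `a` alone generates `I` up to closure and is used twice.
  by_cases hb0 : b = 0
  · exact ⟨a, a, ha, ha, key a haI fun L hL haL _ => hb L hL haL (hb0 ▸ L.zero_mem)⟩
  · exact ⟨a, b, ha, hb0, key b hbI hb⟩

/-- In a Krull domain every divisorial ideal is, up to a scalar, the intersection of two principal
ideals. -/
theorem IsKrullDomain.exists_eq_spanSingleton_mul_inf (hD : IsKrullDomain D) {I : Ideal D}
    (hI : I.IsDivisorial) :
    ∃ (t : FractionRing D) (a b : D), t ≠ 0 ∧ a ≠ 0 ∧ b ≠ 0 ∧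
      (I : FractionalIdeal D⁰ (FractionRing D)) = spanSingleton D⁰ t *
        ((Ideal.span {a} ⊓ Ideal.span {b} : Ideal D) :
          FractionalIdeal D⁰ (FractionRing D)) := by
  have hI0 : (I : FractionalIdeal D⁰ (FractionRing D)) ≠ 0 := coeIdeal_ne_zero.2 hI.1
  obtain ⟨s, hsI, hs⟩ := Submodule.exists_mem_ne_zero_of_ne_bot hI.1
  have hs' : algebraMap D (FractionRing D) s ≠ 0 := by simpa using hs
  have hinv := inv_spanSingleton_mul (inv_ne_zero hs')
    (I : FractionalIdeal D⁰ (FractionRing D))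
  rw [inv_inv] at hinv
  -- The two generators are wanted for `I⁻¹`, so it is scaled by `s ∈ I` to the integral ideal `L =
  -- sI⁻¹`.
  obtain ⟨L, hL, hLI⟩ := Ideal.exists_isDivisorial_coe_eq
    (mul_ne_zero_of_ne_zero (spanSingleton_ne_zero_iff.2 (inv_ne_zero hs')) hI0) (by
      rw [hinv, spanSingleton_mul_le_iff]
      intro z hz
      rw [mul_comm]
      exact (mem_inv_iff hI0).1 hz _ (mem_coeIdeal_of_mem D⁰ hsI))
  obtain ⟨a, b, ha, hb, hab⟩ := hD.exists_inv_eq_inv_sup hL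
  have ha' : algebraMap D (FractionRing D) a ≠ 0 := by simpa using ha
  have hb' : algebraMap D (FractionRing D) b ≠ 0 := by simpa using hb
  -- `L⁻¹ = s⁻¹I` equals `(a, b)⁻¹`, and `(a, b) = ab(1/b, 1/a)`; hence the scalar `s/ab` and the
  -- swapped order.
  refine ⟨algebraMap D (FractionRing D) s *
    (algebraMap D (FractionRing D) a * algebraMap D (FractionRing D) b)⁻¹, b, a,
    mul_ne_zero hs' (inv_ne_zero (mul_ne_zero ha' hb')), hb, ha, ?_⟩
  rw [← inv_spanSingleton_inv_sup hb ha, ← spanSingleton_mul_spanSingleton, mul_assoc,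
    ← inv_spanSingleton_mul (mul_ne_zero ha' hb'), sup_eq_add, mul_add,
    spanSingleton_mul_spanSingleton, spanSingleton_mul_spanSingleton,
    mul_inv_cancel_right₀ hb', mul_comm (algebraMap D (FractionRing D) a),
    mul_inv_cancel_right₀ ha', ← sup_eq_add, ← hab, hLI, hinv, inv_spanSingleton_mul hs', hI.2,
    ← mul_assoc, spanSingleton_mul_spanSingleton, mul_inv_cancel₀ hs', spanSingleton_one, one_mul]

theorem IsKrullDomain.isDivisorial_sq (hD : IsKrullDomain D) (hstar : IsStarDomain D)
    {I : Ideal D} (hI : I.IsDivisorial) : (I ^ 2).IsDivisorial := by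
  obtain ⟨t, a, b, ht, ha, hb, h⟩ := hD.exists_eq_spanSingleton_mul_inf hI
  refine ⟨pow_ne_zero 2 hI.1, ?_⟩
  rw [coeIdeal_pow, h, mul_pow, ← coeIdeal_pow, ← hstar, spanSingleton_pow,
    inv_spanSingleton_mul (pow_ne_zero 2 ht),
    inv_spanSingleton_mul (inv_ne_zero (pow_ne_zero 2 ht)), inv_inv,
    (Ideal.isDivisorial_span_inf_span (pow_ne_zero 2 ha) (pow_ne_zero 2 hb)).2]

end Krull

theorem proposition71 (D : Type*) [CommRing D] [IsDomain D] (hD : IsKrullDomain D) :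
    IsStarDomain D ↔ ∀ I : Ideal D, I.IsDivisorial → (I ^ 2).IsDivisorial :=
  ⟨fun h _ hI => hD.isDivisorial_sq h hI, hD.hasTrivialMultipliers.isStarDomain⟩
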